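/- **Setting.** A finite set of participants communicates through reliable FIFO channels; disjoint groups have $2f+1$ members each, at most $f$ of which crash. In every run there is a time $\mathsf{GST}$ after which nobody crashes and messages take at most $\delta$; local steps take no time. Every application message $m$ is multicast at most once, to a set $\mathrm{dest}(m)$ of groups. Messages $m\ne m'$ *conflict* if $\mathrm{dest}(m)\cap\mathrm{dest}(m')\neq\emptyset$; they are *concurrent* if each is multicast before the other has been delivered by some member of every one of its destination groups. The *delivery latency* of $m$ at $g\in\mathrm{dest}(m)$ is the time from the multicast of $m$ to its first delivery by a member of $g$. A protocol *has failure-free latency* $\Delta\in[0,\infty]$ if in every run there is a time $t\ge\mathsf{GST}$ such that every message multicast after $t$ has delivery latency at most $\Delta$ at all its destination groups. It *has collision-free latency* $\Delta$ if the same holds for those messages multicast after $t$ that do not conflict with any other, concurrent message multicast by a correct participant. $\mathit{FFL}$ and $\mathit{CFL}$ denote the least (infimal) such bounds. **Skeen-based protocols.** A message-passing protocol $\mathcal A$ is Skeen-based if it implements atomic multicast correctly (validity, integrity, ordering, termination) and: 1. In every run, from some time $t\ge\mathsf{GST}$ on, each group has a quorum of $f+1$ correct members permanently following one of them as leader, and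 all correct participants know these leaders. 2. From such a time on, leaders order and deliver messages by the rules of Skeen's protocol. A leader handles only messages multicast to its group. Its clock never decreases and is no lower than the local timestamps of its proposed and the global timestamps of its committed messages. A new message gets a local timestamp (clock value, group) beyond the old clock value and then is proposed until it is committed, and commits and timestamps are final. The global timestamp of a message multicast after $t$ is the maximum of the local timestamps at its destination groups. The leader delivers exactly the committed messages $m$ such that all proposed messages have local timestamps above the global timestamp of $m$, and does so at once; other members deliver a message multicast after $t$ only when the leader has delivered it. 3. A message is handled up to its commit independently of other messages: for every message multicast after $t$ there is a run in which, arbitrarily late, messages with the same destinations that meet no conflicting concurrent message have the same commit latencies at the leaders of all destination groups. Choose for every run a time $t$ and leaders as in 1. Let $D$ (the commit latency) be the supremum, over all runs, messages $m$ multicast after $t$, and $g\in\mathrm{dest}(m)$, of the time from the multicast of $m$ to its commit at the leader of $g$. Let $C$ (the clock update latency) be the corresponding supremum of the time from the multicast of $m$ until the clock of the leader of $g$ is no lower than the integer part of the global timestamp of $m$. *Worst-case convoys are possible* if for all $c<C$ and $d<D$ there is a run in which, arbitrarily late, some message $m'$ is multicast at least $c$ after a message $m$, still gets a local timestamp not above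 the global timestamp of $m$ at the leader of a common destination group, and has commit latency at least $d$ there. **Theorem.** Let $\mathcal A$ be a Skeen-based atomic multicast implementation. Then $\mathcal A$ has failure-free latency $C+\mathit{CFL}$. If $\mathit{CFL}<\infty$, then this bound is the least one, $\mathit{FFL}=C+\mathit{CFL}$, if and only if worst-case convoys are possible. -/

import Mathlib

open scoped ENNReal

noncomputable section

namespace Multicast

universe u v w x y

/-! ### The system: groups of `2f+1` members, application messages, delay bound -/

/-- The static data of the system: pairwise disjoint groups of `2f+1` members each,
the destination groups of every application message, and the bound `δ` on message delays. -/
structure System (P : Type u) (G : Type v) (M : Type w) where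
  f : ℕ
  member : G → Finset P
  disjoint : ∀ g h, g ≠ h → Disjoint (member g) (member h)
  card_member : ∀ g, (member g).card = 2 * f + 1
  dest : M → Finset G
  δ : ℝ
  δ_pos : 0 < δ

/-- What can happen in one step of a run. `idle` lets time pass. -/
inductive Action (P : Type u) (M : Type w) (Msg : Type y) where
  | multicast (m : M)
  | receive (sender : P) (msg : Msg)
  | internal
  | crash
  | idle

/-- Phases of an application message at a group leader. `proposed` stands for every phase
between the assignment of a local timestamp and the commit. -/
inductive Phase where
  | start
  | proposed
  | committed

/-- Timestamps: pairs (integer, group), ordered lexicographically. -/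
abbrev TS (G : Type v) := ℕ ×ₗ G

/-- The integer part of a timestamp. -/
def TS.time {G : Type v} (ts : TS G) : ℕ := (ofLex ts).1

/-- The variables that a member of a group maintains in a protocol of Skeen's type.
`follows` is the member it currently regards as the leader of its own group (`none` during a
leader change; itself if it is the leader); `curLeader` is its guess of all group leaders. -/
structure View (P : Type u) (G : Type v) (M : Type w) where
  clock : ℕ
  phase : M → Phase
  localTS : M → TS G
  globalTS : M → TS G
  follows : Option P
  curLeader : G → P

/-- An infinite timed sequence of steps. Step `k` is taken by `proc k` at time `time k` and leads
from the configuration `cfg k` to `cfg (k + 1)`. In it, `sent k q` is the list of protocol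
messages sent to `q`, and `deliv k` the list of application messages delivered, in order. -/
structure Execution (P : Type u) (M : Type w) (S : Type x) (Msg : Type y) where
  time : ℕ → ℝ
  proc : ℕ → P
  act : ℕ → Action P M Msg
  cfg : ℕ → P → S
  sent : ℕ → P → List Msg
  deliv : ℕ → List M

namespace Execution

variable {P : Type u} {M : Type w} {S : Type x} {Msg : Type y}

/-- A correct participant never crashes. -/
def Correct (E : Execution P M S Msg) (p : P) : Prop :=
  ∀ k, E.proc k = p → E.act k ≠ Action.crash

open Classical in
/-- The messages sent from `q` to `p` in the first `k` steps. -/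
def sentSeq (E : Execution P M S Msg) (q p : P) (k : ℕ) : List Msg :=
  (List.range k).flatMap fun i => if E.proc i = q then E.sent i p else []

open Classical in
/-- The messages from `q` received by `p` in the first `k` steps. -/
def recvSeq (E : Execution P M S Msg) (q p : P) (k : ℕ) : List Msg :=
  (List.range k).flatMap fun i =>
    if E.proc i = p then
      match E.act i with
      | Action.receive q' msg => if q' = q then [msg] else []
      | _ => []
    else []

open Classical in
/-- The application messages delivered by `p` in the first `k` steps. -/
def delivSeq (E : Execution P M S Msg) (p : P) (k : ℕ) : List M :=
  (List.range k).flatMap fun i => if E.proc i = p then E.deliv i else []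

/-- `m` is multicast in step `i`. -/
def MulticastAt (E : Execution P M S Msg) (m : M) (i : ℕ) : Prop :=
  E.act i = Action.multicast m

/-- `p` delivers `m` in step `k`. -/
def DeliversAt (E : Execution P M S Msg) (p : P) (m : M) (k : ℕ) : Prop :=
  E.proc k = p ∧ m ∈ E.deliv k

end Execution

set_option linter.checkUnivs false in
/-- A message-passing protocol: a (nondeterministic) automaton. The step relation covers
multicast, receive and internal actions; `step p a s s' out del` says that `p` in state `s` may
react to `a` by moving to `s'`, sending the messages `out q` to each `q`, and delivering the
application messages `del`. `admissible` singles out the executions in which the services that the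
protocol relies on (leader selection, retransmission timers) keep their guarantees.
`view` reads the multicast variables off the local state. -/
structure Protocol (P : Type u) (G : Type v) (M : Type w) where
  State : Type x
  Msg : Type y
  init : P → State
  step : P → Action P M Msg → State → State → (P → List Msg) → List M → Prop
  admissible : Execution P M State Msg → Prop
  view : State → View P G M

variable {P : Type u} {G : Type v} {M : Type w}

/-- A run of the protocol `A` in the system `Y`, with its global stabilization time. -/
structure Run (Y : System P G M) (A : Protocol.{u, v, w, x, y} P G M)
    extends Execution P M A.State A.Msg where
  gst : ℝ
  admissible : A.admissible toExecution
  time_mono : Monotone time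
  time_unbounded : Filter.Tendsto time Filter.atTop Filter.atTop
  cfg_zero : cfg 0 = A.init
  /-- Only the acting participant changes its state. -/
  cfg_other : ∀ k p, p ≠ proc k → cfg (k + 1) p = cfg k p
  /-- Crashing and idling change nothing; every other step is a step of the protocol. -/
  cfg_step : ∀ k,
    (act k = Action.crash ∨ act k = Action.idle →
      cfg (k + 1) (proc k) = cfg k (proc k) ∧ (∀ q, sent k q = []) ∧ deliv k = []) ∧
    (act k ≠ Action.crash → act k ≠ Action.idle →
      A.step (proc k) (act k) (cfg k (proc k)) (cfg (k + 1) (proc k)) (sent k) (deliv k))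
  /-- A crashed participant takes no further steps. -/
  crash_stop : ∀ i j, act i = Action.crash → i < j → act j ≠ Action.idle → proc j ≠ proc i
  /-- At most `f` members of a group crash. -/
  crash_card : ∀ g, ∀ F ⊆ Y.member g, (∀ p ∈ F, ¬ toExecution.Correct p) → F.card ≤ Y.f
  /-- There are no crashes after the global stabilization time. -/
  crash_gst : ∀ k, act k = Action.crash → time k ≤ gst
  /-- Application messages are unique. -/
  multicast_unique : ∀ m i j,
    toExecution.MulticastAt m i → toExecution.MulticastAt m j → i = j
  /-- Channels are FIFO and deliver only what has been sent before. -/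
  fifo : ∀ q p k, toExecution.recvSeq q p (k + 1) <+: toExecution.sentSeq q p k
  /-- Channels between correct participants are reliable. -/
  reliable : ∀ q p, toExecution.Correct q → toExecution.Correct p →
    ∀ k, ∃ l, (toExecution.sentSeq q p k).length ≤ (toExecution.recvSeq q p l).length
  /-- After the global stabilization time messages take at most `δ`: if the `n`-th message from
  `q` to `p` is sent in step `i` and received in step `j`, then `j` comes in time. -/
  delay : ∀ q p n i j,
    (toExecution.sentSeq q p i).length ≤ n → n < (toExecution.sentSeq q p (i + 1)).length →
    (toExecution.recvSeq q p j).length = n → (toExecution.recvSeq q p (j + 1)).length = n + 1 →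
    time j ≤ max (time i) gst + Y.δ

namespace Run

variable {Y : System P G M} {A : Protocol.{u, v, w, x, y} P G M}

/-- The multicast variables of `p` just before step `k`. -/
def viewAt (R : Run Y A) (p : P) (k : ℕ) : View P G M := A.view (R.cfg k p)

/-- Just before step `k`, `m` is partially delivered: in each of its destination groups, some
member has delivered it. -/
def PartiallyDelivered (R : Run Y A) (m : M) (k : ℕ) : Prop :=
  ∀ g ∈ Y.dest m, ∃ p ∈ Y.member g, ∃ j < k, R.DeliversAt p m j

/-- `m` and `m'` are concurrent: each is multicast before the other is partially delivered. -/
def Concurrent (R : Run Y A) (m m' : M) : Prop :=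
  (∃ i, R.MulticastAt m' i ∧ ¬ R.PartiallyDelivered m i) ∧
  (∃ i, R.MulticastAt m i ∧ ¬ R.PartiallyDelivered m' i)

/-- `m` does not conflict with any other, concurrent message multicast by a correct
participant. -/
def CollisionFree (R : Run Y A) (m : M) : Prop :=
  ∀ m' j, m' ≠ m → R.MulticastAt m' j → R.Correct (R.proc j) → R.Concurrent m m' →
    Disjoint (Y.dest m) (Y.dest m')

/-- The time from step `i` (where `m` is multicast) to the first delivery of `m` in the group `g`
(infinite if there is none). -/
def deliveryLatency (R : Run Y A) (m : M) (i : ℕ) (g : G) : ℝ≥0∞ :=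
  ⨅ (k : ℕ) (_ : ∃ p ∈ Y.member g, R.DeliversAt p m k), ENNReal.ofReal (R.time k - R.time i)

/-! #### The atomic multicast properties -/

def Validity (R : Run Y A) : Prop :=
  ∀ g, ∀ p ∈ Y.member g, ∀ m k, R.DeliversAt p m k →
    g ∈ Y.dest m ∧ ∃ i ≤ k, R.MulticastAt m i

def Integrity (R : Run Y A) : Prop :=
  ∀ p k, (R.delivSeq p k).Nodup

/-- A single total order governs all deliveries: whoever delivers `m` has delivered before it all
smaller multicast messages addressed to it. -/
def Ordering (R : Run Y A) : Prop :=
  ∃ lt : M → M → Prop, IsStrictTotalOrder M lt ∧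
    ∀ (p : P) (m m' : M) (j : ℕ), R.MulticastAt m' j → lt m' m →
      (∃ g ∈ Y.dest m', p ∈ Y.member g) →
      ∀ k a : ℕ, (R.delivSeq p k)[a]? = some m → ∃ b < a, (R.delivSeq p k)[b]? = some m'

def Termination (R : Run Y A) : Prop :=
  ∀ m, ((∃ i, R.MulticastAt m i ∧ R.Correct (R.proc i)) ∨ ∃ p k, R.DeliversAt p m k) →
    ∀ g ∈ Y.dest m, ∃ Q ⊆ Y.member g, Q.card = Y.f + 1 ∧ ∀ p ∈ Q, ∃ k, R.DeliversAt p m k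

/-! #### Stable leaders, commits and clock updates -/

/-- From time `t ≥ GST` on, every group `g` has a quorum of correct members that permanently follow
`ldr g`, one of them, and all correct participants know this leader. -/
def StableFrom (R : Run Y A) (t : ℝ) (ldr : G → P) : Prop :=
  R.gst ≤ t ∧ ∀ g,
    (∃ Q ⊆ Y.member g, Q.card = Y.f + 1 ∧ (∀ q ∈ Q, R.Correct q) ∧ ldr g ∈ Q ∧
      ∀ k, t ≤ R.time k → ∀ q ∈ Q, (R.viewAt q k).follows = some (ldr g)) ∧
    ∀ k, t ≤ R.time k → ∀ p, R.Correct p → (R.viewAt p k).curLeader g = ldr g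

/-- The time from step `i` (where `m` is multicast) until `p` commits `m`. -/
def commitLatency (R : Run Y A) (p : P) (m : M) (i : ℕ) : ℝ≥0∞ :=
  ⨅ (k : ℕ) (_ : i ≤ k ∧ (R.viewAt p (k + 1)).phase m = Phase.committed),
    ENNReal.ofReal (R.time k - R.time i)

/-- The time from step `i` (where `m` is multicast) until the clock of `p` is no lower than the
global timestamp with which `p` commits `m` (possibly at a later step `l`). -/
def clockUpdateLatency (R : Run Y A) (p : P) (m : M) (i : ℕ) : ℝ≥0∞ :=
  ⨅ (k : ℕ) (_ : i ≤ k ∧ ∃ l, i ≤ l ∧ (R.viewAt p (l + 1)).phase m = Phase.committed ∧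
      ((R.viewAt p (l + 1)).globalTS m).time ≤ (R.viewAt p (k + 1)).clock),
    ENNReal.ofReal (R.time k - R.time i)

/-- No message in the phase `proposed` at `p` (before step `k`) may still get a global timestamp
at or below that of `m`. -/
def Unblocked [LinearOrder G] (R : Run Y A) (p : P) (m : M) (k : ℕ) : Prop :=
  ∀ m', (R.viewAt p k).phase m' = Phase.proposed →
    (R.viewAt p k).globalTS m < (R.viewAt p k).localTS m'

/-- From time `t` on, the group leaders `ldr g` order and deliver messages by the rules of Skeen's
protocol. -/
structure FollowsSkeen [LinearOrder G] (R : Run Y A) (t : ℝ) (ldr : G → P) : Prop where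
  /-- A leader only handles messages that were multicast to its group. -/
  known : ∀ g k m, t ≤ R.time k → (R.viewAt (ldr g) k).phase m ≠ Phase.start →
    g ∈ Y.dest m ∧ ∃ i < k, R.MulticastAt m i
  /-- Clocks never decrease. -/
  clock_mono : ∀ g k, t ≤ R.time k → (R.viewAt (ldr g) k).clock ≤ (R.viewAt (ldr g) (k + 1)).clock
  /-- A new message gets a local timestamp by advancing the clock beyond its old value. -/
  assign : ∀ g k m, t ≤ R.time k → (R.viewAt (ldr g) k).phase m = Phase.start →
    (R.viewAt (ldr g) (k + 1)).phase m ≠ Phase.start →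
    ∃ c, (R.viewAt (ldr g) (k + 1)).localTS m = toLex (c, g) ∧
      (R.viewAt (ldr g) k).clock < c ∧ c ≤ (R.viewAt (ldr g) (k + 1)).clock
  /-- Local timestamps are not changed. -/
  keep_local : ∀ g k m, t ≤ R.time k → (R.viewAt (ldr g) k).phase m ≠ Phase.start →
    (R.viewAt (ldr g) (k + 1)).phase m ≠ Phase.start ∧
    (R.viewAt (ldr g) (k + 1)).localTS m = (R.viewAt (ldr g) k).localTS m
  /-- Commits are final. -/
  keep_global : ∀ g k m, t ≤ R.time k → (R.viewAt (ldr g) k).phase m = Phase.committed →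
    (R.viewAt (ldr g) (k + 1)).phase m = Phase.committed ∧
    (R.viewAt (ldr g) (k + 1)).globalTS m = (R.viewAt (ldr g) k).globalTS m
  /-- The clock is no lower than the local timestamps issued. -/
  local_le_clock : ∀ g k m, t ≤ R.time k → (R.viewAt (ldr g) k).phase m = Phase.proposed →
    ((R.viewAt (ldr g) k).localTS m).time ≤ (R.viewAt (ldr g) k).clock
  /-- A message is committed only after the clock has been advanced to its global timestamp. -/
  global_le_clock : ∀ g k m, t ≤ R.time k → (R.viewAt (ldr g) k).phase m = Phase.committed →
    ((R.viewAt (ldr g) k).globalTS m).time ≤ (R.viewAt (ldr g) k).clock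
  /-- The global timestamp is the maximum of the local timestamps at the destination groups. -/
  global_max : ∀ g k m i, R.MulticastAt m i → t < R.time i → i ≤ k →
    (R.viewAt (ldr g) k).phase m = Phase.committed →
    (∀ h ∈ Y.dest m, (R.viewAt (ldr h) k).phase m ≠ Phase.start) ∧
    IsGreatest {ts | ∃ h ∈ Y.dest m, ts = (R.viewAt (ldr h) k).localTS m}
      ((R.viewAt (ldr g) k).globalTS m)
  /-- A leader delivers only committed messages that are not blocked by proposed ones. -/
  deliver_only : ∀ g k m, t ≤ R.time k → R.DeliversAt (ldr g) m k →
    (R.viewAt (ldr g) (k + 1)).phase m = Phase.committed ∧ R.Unblocked (ldr g) m (k + 1)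
  /-- A leader delivers all these messages at once. -/
  deliver_all : ∀ g k m, t ≤ R.time k →
    (R.viewAt (ldr g) (k + 1)).phase m = Phase.committed → R.Unblocked (ldr g) m (k + 1) →
    ∃ j, R.time j ≤ R.time k ∧ R.DeliversAt (ldr g) m j
  /-- The other members of a group deliver only what the leader has delivered. -/
  leader_first : ∀ g k m i, R.MulticastAt m i → t < R.time i →
    (∃ p ∈ Y.member g, R.DeliversAt p m k) → ∃ j ≤ k, R.DeliversAt (ldr g) m j

end Run

namespace Protocol

variable (Y : System P G M) (A : Protocol.{u, v, w, x, y} P G M)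

/-- `A` is a correct implementation of atomic multicast. -/
def IsAtomicMulticast : Prop :=
  ∀ R : Run Y A, R.Validity ∧ R.Integrity ∧ R.Ordering ∧ R.Termination

/-- `A` has a failure-free latency of `Δ`. -/
def HasFailureFreeLatency (Δ : ℝ≥0∞) : Prop :=
  ∀ R : Run Y A, ∃ t, R.gst ≤ t ∧ ∀ m i, R.MulticastAt m i → t < R.time i →
    ∀ g ∈ Y.dest m, R.deliveryLatency m i g ≤ Δ

/-- `A` has a collision-free latency of `Δ`. -/
def HasCollisionFreeLatency (Δ : ℝ≥0∞) : Prop :=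
  ∀ R : Run Y A, ∃ t, R.gst ≤ t ∧ ∀ m i, R.MulticastAt m i → t < R.time i →
    R.CollisionFree m → ∀ g ∈ Y.dest m, R.deliveryLatency m i g ≤ Δ

/-- The failure-free latency: the best bound. -/
def failureFreeLatency : ℝ≥0∞ := sInf {Δ | A.HasFailureFreeLatency Y Δ}

/-- The collision-free latency: the best bound. -/
def collisionFreeLatency : ℝ≥0∞ := sInf {Δ | A.HasCollisionFreeLatency Y Δ}

/-- A choice, for every run, of a time from which its group leaders are stable, and of these
leaders. -/
structure Stabilization where
  t : Run Y A → ℝ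
  ldr : Run Y A → G → P
  stable : ∀ R : Run Y A, R.StableFrom (t R) (ldr R)

/-- `A` is a Skeen-based implementation of atomic multicast: a correct one, in which leaders
eventually stabilize and then order and deliver messages by the rules of Skeen's protocol, and which
handles each message up to its commit independently of the other messages: the way in which it is
committed can be replayed, arbitrarily late, by a message with the same destinations in a run in
which this message meets no conflicting concurrent ones. -/
structure SkeenBased [LinearOrder G] : Prop where
  correct : A.IsAtomicMulticast Y
  stabilizes : ∀ R : Run Y A, ∃ (t : ℝ) (ldr : G → P), R.StableFrom t ldr
  skeen : ∀ (R : Run Y A) (t : ℝ) (ldr : G → P), R.StableFrom t ldr → R.FollowsSkeen t ldr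
  replay : ∀ (R : Run Y A) (t : ℝ) (ldr : G → P), R.StableFrom t ldr →
    ∀ m i, R.MulticastAt m i → t < R.time i →
    ∃ (R' : Run Y A) (t' : ℝ) (ldr' : G → P), R'.StableFrom t' ldr' ∧
      ∀ T : ℝ, ∃ m' i', R'.MulticastAt m' i' ∧ T < R'.time i' ∧ R'.CollisionFree m' ∧
        Y.dest m' = Y.dest m ∧
        ∀ g ∈ Y.dest m, R'.commitLatency (ldr' g) m' i' = R.commitLatency (ldr g) m i

variable {Y A}

namespace Stabilization

variable (σ : Stabilization Y A)

/-- The commit latency `D`: the maximal time between the multicast of a message, after leaders have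
stabilized, and its commit at the leader of a destination group. -/
def commitLatency : ℝ≥0∞ :=
  ⨆ (R : Run Y A) (m : M) (i : ℕ) (_ : R.MulticastAt m i ∧ σ.t R < R.time i)
    (g : G) (_ : g ∈ Y.dest m), R.commitLatency (σ.ldr R g) m i

/-- The clock update latency `C`: the maximal time between the multicast of a message, after leaders
have stabilized, and the moment when the leader of a destination group has advanced its clock to
the global timestamp of the message. -/
def clockUpdateLatency : ℝ≥0∞ :=
  ⨆ (R : Run Y A) (m : M) (i : ℕ) (_ : R.MulticastAt m i ∧ σ.t R < R.time i)
    (g : G) (_ : g ∈ Y.dest m), R.clockUpdateLatency (σ.ldr R g) m i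

/-- Worst-case convoys are possible: for all `c < C` and `d < D` there is a run in which,
arbitrarily late, a message `m'` is multicast at least `c` after a message `m`, is still given a
local timestamp not above the global timestamp of `m` by the leader of a common destination group,
and takes at least `d` to be committed there. -/
def HasWorstCaseConvoys [LinearOrder G] : Prop :=
  ∀ c < σ.clockUpdateLatency, ∀ d < σ.commitLatency, ∃ R : Run Y A, ∀ T : ℝ,
    ∃ m i m' i', R.MulticastAt m i ∧ R.MulticastAt m' i' ∧ T < R.time i ∧
      c ≤ ENNReal.ofReal (R.time i' - R.time i) ∧
      ∃ g ∈ Y.dest m ∩ Y.dest m',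
        (∃ k, i ≤ k ∧ (R.viewAt (σ.ldr R g) k).phase m = Phase.committed ∧
          (R.viewAt (σ.ldr R g) k).phase m' ≠ Phase.start ∧
          (R.viewAt (σ.ldr R g) k).localTS m' ≤ (R.viewAt (σ.ldr R g) k).globalTS m) ∧
        d ≤ R.commitLatency (σ.ldr R g) m' i'

end Stabilization

end Protocol

end Multicast

end

/-!
Throughout, `D` is the commit latency, `C` the clock update latency, and everything happens after
the leaders have stabilized. A committed message `m` is delivered by the leader of a group unless it
is blocked there by a proposed message `m'` whose local timestamp is not above the global timestamp
of `m`.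

*Old messages.* A message multicast before stabilization might stay proposed forever, without being
covered by the bound `D`. It would then block every later message to the group, since these get
larger timestamps, in contradiction to termination. Hence it does not block late messages
(`Run.FollowsSkeen.eventually_not_proposed`, `Run.FollowsSkeen.eventually_proposed_late`).

*The collision-free latency is `D`* (`Protocol.SkeenBased.collisionFreeLatency_eq`). A blocking
message is a conflicting, concurrent one, so that collision-free messages are delivered upon commit.
Conversely every commit latency recurs, by replay, as that of a late collision-free message, which
cannot be delivered before it is committed.

*Upper bound.* Once the clock of the leader has reached the global timestamp of `m`, new messages
get larger local timestamps. So messages blocking `m` are multicast at most `C` after `m`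
(`Run.FollowsSkeen.multicast_le_of_localTS_le`) and committed at most `D` later, which bounds the
delivery latency by `C + D` (`Protocol.SkeenBased.hasFailureFreeLatency_add`). If worst-case
convoys are impossible, as witnessed by `c < C` and `d < D`, then a blocking message is multicast
less than `c` after `m` or committed in less than `d`; this gives the bound `max (c + D) (C + d)`,
which is less than `C + D` (`Protocol.SkeenBased.exists_hasFailureFreeLatency_lt`).

*Lower bound.* In a convoy with parameters `c` and `d`, the message `m` cannot be delivered before
`m'` is committed, hence not before `c + d` has passed
(`Run.FollowsSkeen.add_le_deliveryLatency_of_convoy`). As `C ≤ D`, the case that `C` or `D` vanishes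
reduces to the trivial inequality between collision-free and failure-free latency.
-/

open scoped ENNReal

namespace Multicast

universe u v w x y

variable {P : Type u} {G : Type v} {M : Type w}
variable {Y : System P G M} {A : Protocol.{u, v, w, x, y} P G M}

theorem TS.time_le_of_le [LinearOrder G] {a b : TS G} (h : a ≤ b) : a.time ≤ b.time := by
  rcases (Prod.Lex.le_iff).1 h with h | h
  · exact le_of_lt h
  · exact le_of_eq h.1

namespace Run

variable {R : Run Y A} {t : ℝ} {ldr : G → P}

/-! ### Runs after stabilization -/

/-- Crashes happen before `GST`, so whoever multicasts afterwards is correct. -/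
theorem correct_of_multicastAt {m : M} {i : ℕ} (hm : R.MulticastAt m i) (hi : R.gst < R.time i) :
    R.Correct (R.proc i) := by
  intro k hk hc
  have hm' : R.act i = Action.multicast m := hm
  have hki : k < i := by
    by_contra h
    exact absurd (R.time_mono (not_lt.1 h)) (not_le.2 (lt_of_le_of_lt (R.crash_gst k hc) hi))
  exact Run.crash_stop R k i hc hki (by simp [hm']) hk.symm

theorem lt_of_time_lt {i j : ℕ} (h : R.time i < R.time j) : i < j := by
  by_contra h'
  exact absurd (R.time_mono (not_lt.1 h')) (not_le.2 h)

/-- For every time `B` not before step `i`, there is a last step up to time `B`. -/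
theorem exists_last_step {i : ℕ} {B : ℝ} (hB : R.time i ≤ B) :
    ∃ K, R.time K ≤ B ∧ ∀ k, R.time k ≤ B → k ≤ K := by
  classical
  have hex : ∃ N, B < R.time N := (R.time_unbounded.eventually_gt_atTop B).exists
  have hN := Nat.find_spec hex
  have hpos : 0 < Nat.find hex := by
    rcases Nat.eq_zero_or_pos (Nat.find hex) with h | h
    · rw [h] at hN
      exact absurd (R.time_mono (Nat.zero_le i)) (not_le.2 (lt_of_le_of_lt hB hN))
    · exact h
  refine ⟨Nat.find hex - 1, not_lt.1 (Nat.find_min hex (by omega)), fun k hk ↦ ?_⟩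
  have := R.lt_of_time_lt (lt_of_le_of_lt hk hN)
  omega

/-- The infimum that defines the commit latency is attained when it is finite. -/
theorem exists_committed_of_commitLatency_le {p : P} {m : M} {i : ℕ} {d : ℝ≥0∞} (hd : d ≠ ⊤)
    (h : R.commitLatency p m i ≤ d) :
    ∃ k, i ≤ k ∧ (R.viewAt p (k + 1)).phase m = Phase.committed ∧
      R.time k ≤ R.time i + d.toReal := by
  classical
  by_cases hex : ∃ k, i ≤ k ∧ (R.viewAt p (k + 1)).phase m = Phase.committed
  · refine ⟨Nat.find hex, (Nat.find_spec hex).1, (Nat.find_spec hex).2, ?_⟩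
    have h1 : ENNReal.ofReal (R.time (Nat.find hex) - R.time i) ≤ R.commitLatency p m i :=
      le_iInf₂ fun k hk ↦ ENNReal.ofReal_le_ofReal
        (sub_le_sub_right (R.time_mono (Nat.find_min' hex hk)) _)
    have := (ENNReal.ofReal_le_iff_le_toReal hd).1 (h1.trans h)
    linarith
  · have : R.commitLatency p m i = ⊤ := by
      simp only [commitLatency, iInf_eq_top]
      exact fun k hk ↦ absurd ⟨k, hk⟩ hex
    exact absurd (top_le_iff.1 (this ▸ h)) hd

/-- The infimum that defines the clock update latency is attained when it is finite. -/
theorem exists_clock_of_clockUpdateLatency_le {p : P} {m : M} {i : ℕ} {c : ℝ≥0∞} (hc : c ≠ ⊤)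
    (h : R.clockUpdateLatency p m i ≤ c) :
    ∃ k, i ≤ k ∧ R.time k ≤ R.time i + c.toReal ∧
      ∃ l, i ≤ l ∧ (R.viewAt p (l + 1)).phase m = Phase.committed ∧
        ((R.viewAt p (l + 1)).globalTS m).time ≤ (R.viewAt p (k + 1)).clock := by
  classical
  by_cases hex : ∃ k, i ≤ k ∧ ∃ l, i ≤ l ∧ (R.viewAt p (l + 1)).phase m = Phase.committed ∧
        ((R.viewAt p (l + 1)).globalTS m).time ≤ (R.viewAt p (k + 1)).clock
  · refine ⟨Nat.find hex, (Nat.find_spec hex).1, ?_, (Nat.find_spec hex).2⟩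
    have h1 : ENNReal.ofReal (R.time (Nat.find hex) - R.time i) ≤ R.clockUpdateLatency p m i :=
      le_iInf₂ fun k hk ↦ ENNReal.ofReal_le_ofReal
        (sub_le_sub_right (R.time_mono (Nat.find_min' hex hk)) _)
    have := (ENNReal.ofReal_le_iff_le_toReal hc).1 (h1.trans h)
    linarith
  · have : R.clockUpdateLatency p m i = ⊤ := by
      simp only [clockUpdateLatency, iInf_eq_top]
      exact fun k hk ↦ absurd ⟨k, hk⟩ hex
    exact absurd (top_le_iff.1 (this ▸ h)) hc

/-! ### Timestamps at a leader -/

namespace FollowsSkeen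

variable [LinearOrder G] (hF : R.FollowsSkeen t ldr)

include hF

theorem clock_le {a b : ℕ} (g : G) (ha : t ≤ R.time a) (hab : a ≤ b) :
    (R.viewAt (ldr g) a).clock ≤ (R.viewAt (ldr g) b).clock := by
  induction b, hab using Nat.le_induction with
  | base => exact le_rfl
  | succ b hb ih => exact ih.trans (hF.clock_mono g b (ha.trans (R.time_mono hb)))

theorem committed_of_le {a b : ℕ} {g : G} {m : M} (ha : t ≤ R.time a) (hab : a ≤ b)
    (h : (R.viewAt (ldr g) a).phase m = Phase.committed) :
    (R.viewAt (ldr g) b).phase m = Phase.committed ∧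
      (R.viewAt (ldr g) b).globalTS m = (R.viewAt (ldr g) a).globalTS m := by
  induction b, hab using Nat.le_induction with
  | base => exact ⟨h, rfl⟩
  | succ b hb ih =>
    have := hF.keep_global g b m (ha.trans (R.time_mono hb)) ih.1
    exact ⟨this.1, this.2.trans ih.2⟩

theorem globalTS_eq {a b : ℕ} {g : G} {m : M} (ha : t ≤ R.time a) (hb : t ≤ R.time b)
    (hca : (R.viewAt (ldr g) a).phase m = Phase.committed)
    (hcb : (R.viewAt (ldr g) b).phase m = Phase.committed) :
    (R.viewAt (ldr g) a).globalTS m = (R.viewAt (ldr g) b).globalTS m := by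
  rcases le_total a b with h | h
  · exact (hF.committed_of_le ha h hca).2.symm
  · exact (hF.committed_of_le hb h hcb).2

theorem ne_start_of_le {a b : ℕ} {g : G} {m : M} (ha : t ≤ R.time a) (hab : a ≤ b)
    (h : (R.viewAt (ldr g) a).phase m ≠ Phase.start) :
    (R.viewAt (ldr g) b).phase m ≠ Phase.start ∧
      (R.viewAt (ldr g) b).localTS m = (R.viewAt (ldr g) a).localTS m := by
  induction b, hab using Nat.le_induction with
  | base => exact ⟨h, rfl⟩
  | succ b hb ih =>
    have := hF.keep_local g b m (ha.trans (R.time_mono hb)) ih.1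
    exact ⟨this.1, this.2.trans ih.2⟩

theorem localTS_eq {a b : ℕ} {g : G} {m : M} (ha : t ≤ R.time a) (hb : t ≤ R.time b)
    (hna : (R.viewAt (ldr g) a).phase m ≠ Phase.start)
    (hnb : (R.viewAt (ldr g) b).phase m ≠ Phase.start) :
    (R.viewAt (ldr g) a).localTS m = (R.viewAt (ldr g) b).localTS m := by
  rcases le_total a b with h | h
  · exact (hF.ne_start_of_le ha h hna).2.symm
  · exact (hF.ne_start_of_le hb h hnb).2

/-- A message that the leader does not know yet gets a timestamp beyond the current clock value. -/
theorem clock_lt_localTS {a b : ℕ} {g : G} {m : M} (ha : t ≤ R.time a) (hb : t ≤ R.time b)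
    (hsa : (R.viewAt (ldr g) a).phase m = Phase.start)
    (hsb : (R.viewAt (ldr g) b).phase m ≠ Phase.start) :
    (R.viewAt (ldr g) a).clock < ((R.viewAt (ldr g) b).localTS m).time := by
  have hab : a ≤ b := by
    by_contra h
    exact (hF.ne_start_of_le hb (not_le.1 h).le hsb).1 hsa
  clear hb
  induction b, hab using Nat.le_induction with
  | base => exact absurd hsa hsb
  | succ b hab ih =>
    have hb := ha.trans (R.time_mono hab)
    by_cases hs : (R.viewAt (ldr g) b).phase m = Phase.start
    · obtain ⟨c, h1, h2, -⟩ := hF.assign g b m hb hs hsb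
      rw [h1]
      exact (hF.clock_le g ha hab).trans_lt h2
    · rw [(hF.keep_local g b m hb hs).2]
      exact ih hs

theorem multicast_lt {k i : ℕ} {g : G} {m : M} (hk : t ≤ R.time k)
    (h : (R.viewAt (ldr g) k).phase m ≠ Phase.start) (hm : R.MulticastAt m i) : i < k := by
  obtain ⟨-, j, hj, hmj⟩ := hF.known g k m hk h
  exact R.multicast_unique m i j hm hmj ▸ hj

/-- Once the clock has reached the global timestamp of `m`, messages multicast later on get larger
local timestamps. -/
theorem multicast_le_of_localTS_le {m m' : M} {i' u k l : ℕ} {g : G} (hm' : R.MulticastAt m' i')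
    (hu : t ≤ R.time u) (hl : t ≤ R.time l)
    (hcl : (R.viewAt (ldr g) l).phase m = Phase.committed)
    (hclock : ((R.viewAt (ldr g) l).globalTS m).time ≤ (R.viewAt (ldr g) (u + 1)).clock)
    (hk : t ≤ R.time k) (hck : (R.viewAt (ldr g) k).phase m = Phase.committed)
    (hnk : (R.viewAt (ldr g) k).phase m' ≠ Phase.start)
    (hle : (R.viewAt (ldr g) k).localTS m' ≤ (R.viewAt (ldr g) k).globalTS m) : i' ≤ u := by
  by_contra h
  have hu1 : t ≤ R.time (u + 1) := hu.trans (R.time_mono u.le_succ)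
  have hs : (R.viewAt (ldr g) (u + 1)).phase m' = Phase.start := by
    by_contra hs
    have := hF.multicast_lt hu1 hs hm'
    omega
  have h1 := hF.clock_lt_localTS hu1 hk hs hnk
  have h2 := TS.time_le_of_le hle
  rw [hF.globalTS_eq hk hl hck hcl] at h2
  omega

/-! ### Delivery by leaders -/

/-- The leader of `g` delivers `m` no later than the other members, after having committed it. -/
theorem exists_unblocked_of_delivered (hA : A.IsAtomicMulticast Y) (hs : R.StableFrom t ldr)
    {m : M} {i k : ℕ} {g : G} (hm : R.MulticastAt m i) (hi : t < R.time i)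
    (hd : ∃ p ∈ Y.member g, R.DeliversAt p m k) :
    ∃ j, i ≤ j ∧ j ≤ k ∧ (R.viewAt (ldr g) (j + 1)).phase m = Phase.committed ∧
      R.Unblocked (ldr g) m (j + 1) := by
  obtain ⟨j, hjk, hj⟩ := hF.leader_first g k m i hm hi hd
  obtain ⟨Q, hQ, -, -, hl, -⟩ := (hs.2 g).1
  obtain ⟨-, i', hi', hm'⟩ := (hA R).1 g (ldr g) (hQ hl) m j hj
  have hij : i ≤ j := R.multicast_unique m i i' hm hm' ▸ hi'
  exact ⟨j, hij, hjk, hF.deliver_only g j m (hi.le.trans (R.time_mono hij)) hj⟩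

/-- By termination, the leader delivers every message multicast after stabilization; then no
proposed message blocks it. -/
theorem exists_unblocked (hA : A.IsAtomicMulticast Y) (hs : R.StableFrom t ldr) {m : M} {i : ℕ}
    {g : G} (hm : R.MulticastAt m i) (hi : t < R.time i) (hg : g ∈ Y.dest m) :
    ∃ j, i ≤ j ∧ (R.viewAt (ldr g) (j + 1)).phase m = Phase.committed ∧
      R.Unblocked (ldr g) m (j + 1) := by
  obtain ⟨Q, hQ, hc, hd⟩ := (hA R).2.2.2 m
    (Or.inl ⟨i, hm, R.correct_of_multicastAt hm (hs.1.trans_lt hi)⟩) g hg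
  obtain ⟨q, hq⟩ : Q.Nonempty := Finset.card_pos.1 (by omega)
  obtain ⟨k, hk⟩ := hd q hq
  obtain ⟨j, hij, -, hj⟩ := hF.exists_unblocked_of_delivered hA hs hm hi ⟨q, hQ hq, hk⟩
  exact ⟨j, hij, hj⟩

theorem commitLatency_le_deliveryLatency (hA : A.IsAtomicMulticast Y) (hs : R.StableFrom t ldr)
    {m : M} {i : ℕ} (g : G) (hm : R.MulticastAt m i) (hi : t < R.time i) :
    R.commitLatency (ldr g) m i ≤ R.deliveryLatency m i g := by
  refine le_iInf₂ fun k hk ↦ ?_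
  obtain ⟨j, hij, hjk, hc, -⟩ := hF.exists_unblocked_of_delivered hA hs hm hi hk
  exact (iInf₂_le j ⟨hij, hc⟩).trans
    (ENNReal.ofReal_le_ofReal (sub_le_sub_right (R.time_mono hjk) _))

/-- The clock is advanced to the global timestamp before the commit. -/
theorem clockUpdateLatency_le_commitLatency {m : M} {i : ℕ} (g : G) (hi : t < R.time i) :
    R.clockUpdateLatency (ldr g) m i ≤ R.commitLatency (ldr g) m i := by
  refine le_iInf₂ fun k hk ↦ iInf₂_le k ⟨hk.1, k, hk.1, hk.2, ?_⟩
  exact hF.global_le_clock g (k + 1) m (hi.le.trans (R.time_mono (hk.1.trans k.le_succ))) hk.2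

/-- A message does not stay proposed while messages keep being multicast to the group: they would
all be blocked. -/
theorem eventually_not_proposed (hA : A.IsAtomicMulticast Y) (hs : R.StableFrom t ldr) (m' : M)
    (g : G) : ∀ᶠ T in Filter.atTop, ∀ m i k, R.MulticastAt m i → T < R.time i → g ∈ Y.dest m →
      i ≤ k → (R.viewAt (ldr g) k).phase m' ≠ Phase.proposed := by
  by_contra hnot
  have key : ∀ T, ∃ m i k, R.MulticastAt m i ∧ T < R.time i ∧ g ∈ Y.dest m ∧ i ≤ k ∧
      (R.viewAt (ldr g) k).phase m' = Phase.proposed := by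
    intro T
    by_contra h
    push Not at h
    refine hnot ((Filter.eventually_ge_atTop T).mono fun T' hT' m i k hm hi hg hk ↦ ?_)
    exact h m i k hm (lt_of_le_of_lt hT' hi) hg hk
  -- A message `m` is multicast while `m'` is proposed, and `m'` is still proposed when the leader
  -- delivers `m`.
  obtain ⟨-, i₀, k₀, -, hi₀, -, hik₀, hp₀⟩ := key t
  obtain ⟨m, i, -, hm, hi, hg, -⟩ := key (R.time k₀)
  have hk₀ : t ≤ R.time k₀ := hi₀.le.trans (R.time_mono hik₀)
  have hki : k₀ < i := R.lt_of_time_lt hi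
  have hti : t < R.time i := hk₀.trans_lt hi
  obtain ⟨j, hij, hcj, huj⟩ := hF.exists_unblocked hA hs hm hti hg
  obtain ⟨-, i₂, k₂, -, hi₂, -, hik₂, hp₂⟩ := key (R.time (j + 1))
  have hj : t ≤ R.time (j + 1) := hti.le.trans (R.time_mono (by omega))
  have hjk₂ : j + 1 ≤ k₂ := (R.lt_of_time_lt hi₂).le.trans hik₂
  obtain ⟨hn, hl⟩ :=
    hF.ne_start_of_le (g := g) (m := m') hk₀ (show k₀ ≤ j + 1 by omega) (by simp [hp₀])
  have hpj : (R.viewAt (ldr g) (j + 1)).phase m' = Phase.proposed := by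
    cases hph : (R.viewAt (ldr g) (j + 1)).phase m' with
    | start => exact absurd hph hn
    | proposed => rfl
    | committed => simp [(hF.committed_of_le hj hjk₂ hph).1] at hp₂
  have h1 := TS.time_le_of_le (huj m' hpj).le
  obtain ⟨hall, hmax⟩ := hF.global_max g (j + 1) m i hm hti (by omega) hcj
  have h2 := TS.time_le_of_le (hmax.2 ⟨g, hg, rfl⟩)
  have hsm : (R.viewAt (ldr g) i).phase m = Phase.start := by
    by_contra h
    exact lt_irrefl i (hF.multicast_lt hti.le h hm)
  have h3 := hF.clock_lt_localTS hti.le hj hsm (hall g hg)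
  have h4 := hF.clock_le g hk₀ hki.le
  have h5 := hF.local_le_clock g k₀ m' hk₀ hp₀
  rw [hl] at h1
  omega

/-- Late messages are only blocked by messages multicast after stabilization. There are finitely
many others. -/
theorem eventually_proposed_late [Finite G] (hA : A.IsAtomicMulticast Y)
    (hs : R.StableFrom t ldr) :
    ∃ T, t ≤ T ∧ ∀ m i g k m', R.MulticastAt m i → T < R.time i → g ∈ Y.dest m → i ≤ k →
      (R.viewAt (ldr g) k).phase m' = Phase.proposed →
      g ∈ Y.dest m' ∧ ∃ i' < k, R.MulticastAt m' i' ∧ t < R.time i' := by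
  obtain ⟨N, hN⟩ := (R.time_unbounded.eventually_gt_atTop t).exists
  have hall : ∀ n, ∀ g, ∀ᶠ T in Filter.atTop, ∀ m', R.MulticastAt m' n → ∀ m i k,
      R.MulticastAt m i → T < R.time i → g ∈ Y.dest m →
      i ≤ k → (R.viewAt (ldr g) k).phase m' ≠ Phase.proposed := by
    intro n g
    by_cases h : ∃ m', R.MulticastAt m' n
    · obtain ⟨m', hm'⟩ := h
      filter_upwards [hF.eventually_not_proposed hA hs m' g] with T hT m'' hm''
      obtain rfl : m' = m'' := Action.multicast.inj (hm'.symm.trans hm'')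
      exact hT
    · exact Filter.Eventually.of_forall fun T m' hm' ↦ absurd ⟨m', hm'⟩ h
  have hfin := (Filter.eventually_all_finset (Finset.range N)).2 fun n _ ↦
    Filter.eventually_all.2 (hall n)
  obtain ⟨T, hT, htT⟩ := (hfin.and (Filter.eventually_ge_atTop t)).exists
  refine ⟨T, htT, fun m i g k m' hm hi hg hik hp ↦ ?_⟩
  obtain ⟨hg', i', hi', hm'⟩ := hF.known g k m' ((htT.trans hi.le).trans (R.time_mono hik))
    (by simp [hp])
  refine ⟨hg', i', hi', hm', ?_⟩
  by_contra h
  have hiN : i' < N := R.lt_of_time_lt ((not_lt.1 h).trans_lt hN)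
  exact hT i' (Finset.mem_range.2 hiN) g m' hm' m i k hm hi hg hik hp

/-- A message is delivered within `Δ` if it and all messages that may block it are committed by
then. -/
theorem deliveryLatency_le (hs : R.StableFrom t ldr) {m : M} {i : ℕ} {g : G} {Δ : ℝ≥0∞}
    (hΔ : Δ ≠ ⊤) (hi : t < R.time i)
    (hlate : ∀ k m', i ≤ k → (R.viewAt (ldr g) k).phase m' = Phase.proposed →
      g ∈ Y.dest m' ∧ ∃ i' < k, R.MulticastAt m' i' ∧ t < R.time i')
    (hc : R.commitLatency (ldr g) m i ≤ Δ)
    (hblock : ∀ m' i' k, R.MulticastAt m' i' → t < R.time i' → g ∈ Y.dest m' → i ≤ k →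
      (R.viewAt (ldr g) k).phase m = Phase.committed →
      (R.viewAt (ldr g) k).phase m' ≠ Phase.start →
      (R.viewAt (ldr g) k).localTS m' ≤ (R.viewAt (ldr g) k).globalTS m →
      ∃ k', i' ≤ k' ∧ (R.viewAt (ldr g) (k' + 1)).phase m' = Phase.committed ∧
        R.time k' ≤ R.time i + Δ.toReal) :
    R.deliveryLatency m i g ≤ Δ := by
  obtain ⟨k₀, hik₀, hck₀, hk₀⟩ := R.exists_committed_of_commitLatency_le hΔ hc
  obtain ⟨K, hK, hlast⟩ := R.exists_last_step (i := i) (B := R.time i + Δ.toReal) (by simp)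
  have hk₀K := hlast k₀ hk₀
  have hiK : i ≤ K + 1 := by omega
  have hcK := (hF.committed_of_le (hi.le.trans (R.time_mono (by omega)))
    (Nat.succ_le_succ hk₀K) hck₀).1
  have hu : R.Unblocked (ldr g) m (K + 1) := by
    intro m' hp
    by_contra hle
    obtain ⟨hg', i', -, hm', hi'⟩ := hlate (K + 1) m' hiK hp
    obtain ⟨k', hik', hck', hk'⟩ := hblock m' i' (K + 1) hm' hi' hg' hiK hcK (by simp [hp])
      (not_lt.1 hle)
    have := (hF.committed_of_le (hi'.le.trans (R.time_mono (by omega)))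
      (Nat.succ_le_succ (hlast k' hk')) hck').1
    simp [this] at hp
  obtain ⟨j, hjK, hj⟩ := hF.deliver_all g K m (hi.le.trans (R.time_mono (by omega))) hcK hu
  obtain ⟨Q, hQ, -, -, hl, -⟩ := (hs.2 g).1
  refine (iInf₂_le j ⟨ldr g, hQ hl, hj⟩).trans ?_
  rw [ENNReal.ofReal_le_iff_le_toReal hΔ]
  linarith

/-- A late message without collisions is delivered upon commit, since a blocking message would be
conflicting and concurrent. -/
theorem deliveryLatency_le_commitLatency (hA : A.IsAtomicMulticast Y) (hs : R.StableFrom t ldr)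
    {m : M} {i : ℕ} {g : G} (hm : R.MulticastAt m i) (hi : t < R.time i) (hg : g ∈ Y.dest m)
    (hcf : R.CollisionFree m)
    (hlate : ∀ k m', i ≤ k → (R.viewAt (ldr g) k).phase m' = Phase.proposed →
      g ∈ Y.dest m' ∧ ∃ i' < k, R.MulticastAt m' i' ∧ t < R.time i') :
    R.deliveryLatency m i g ≤ R.commitLatency (ldr g) m i := by
  obtain ⟨Q, hQ, -, -, hl, -⟩ := (hs.2 g).1
  refine le_iInf₂ fun k ⟨hik, hck⟩ ↦ ?_
  have hk : t ≤ R.time k := hi.le.trans (R.time_mono hik)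
  by_cases hu : R.Unblocked (ldr g) m (k + 1)
  · obtain ⟨j, hjk, hj⟩ := hF.deliver_all g k m hk hck hu
    exact (iInf₂_le j ⟨ldr g, hQ hl, hj⟩).trans
      (ENNReal.ofReal_le_ofReal (sub_le_sub_right hjk _))
  · simp only [Unblocked, not_forall] at hu
    obtain ⟨m', hp, -⟩ := hu
    obtain ⟨hg', i', hi'k, hm', hi'⟩ := hlate (k + 1) m' (by omega) hp
    have hne : m' ≠ m := by
      rintro rfl
      simp [hck] at hp
    have hnc : ¬ R.Concurrent m m' := fun hc ↦ Finset.disjoint_left.1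
      (hcf m' i' hne hm' (R.correct_of_multicastAt hm' (hs.1.trans_lt hi')) hc) hg hg'
    -- `m'` cannot have been delivered before `m` was multicast, since it is not yet committed.
    have hnd : ¬ R.PartiallyDelivered m' i := by
      intro hd
      obtain ⟨p, hp', j, hj, hpj⟩ := hd g hg'
      obtain ⟨l, hil, hlj, hcl, -⟩ :=
        hF.exists_unblocked_of_delivered hA hs hm' hi' ⟨p, hp', hpj⟩
      have := (hF.committed_of_le (hi'.le.trans (R.time_mono (by omega)))
        (show l + 1 ≤ k + 1 by omega) hcl).1
      simp [this] at hp
    have hd : R.PartiallyDelivered m i' := by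
      by_contra hd
      exact hnc ⟨⟨i', hm', hd⟩, i, hm, hnd⟩
    obtain ⟨p, hp', j, hj, hpj⟩ := hd g hg
    exact (iInf₂_le j ⟨p, hp', hpj⟩).trans
      (ENNReal.ofReal_le_ofReal (sub_le_sub_right (R.time_mono (by omega)) _))

/-- In a convoy, `m` is not delivered before `m'` is committed. -/
theorem add_le_deliveryLatency_of_convoy (hA : A.IsAtomicMulticast Y) (hs : R.StableFrom t ldr)
    {m m' : M} {i i' k : ℕ} {g : G} {c d : ℝ≥0∞} (hm : R.MulticastAt m i)
    (hm' : R.MulticastAt m' i') (hi : t < R.time i) (hc₀ : 0 < c)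
    (hc : c ≤ ENNReal.ofReal (R.time i' - R.time i)) (hik : i ≤ k)
    (hck : (R.viewAt (ldr g) k).phase m = Phase.committed)
    (hnk : (R.viewAt (ldr g) k).phase m' ≠ Phase.start)
    (hle : (R.viewAt (ldr g) k).localTS m' ≤ (R.viewAt (ldr g) k).globalTS m)
    (hd : d ≤ R.commitLatency (ldr g) m' i') : c + d ≤ R.deliveryLatency m i g := by
  refine le_iInf₂ fun n hn ↦ ?_
  obtain ⟨j, hij, hjn, hcj, huj⟩ := hF.exists_unblocked_of_delivered hA hs hm hi hn
  have hk : t ≤ R.time k := hi.le.trans (R.time_mono hik)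
  have hj : t ≤ R.time (j + 1) := hi.le.trans (R.time_mono (by omega))
  have hns : (R.viewAt (ldr g) (j + 1)).phase m' ≠ Phase.start := by
    intro h
    have h1 := hF.clock_lt_localTS hj hk h hnk
    have h2 := TS.time_le_of_le hle
    have h3 := hF.global_le_clock g (j + 1) m hj hcj
    rw [hF.globalTS_eq hj hk hcj hck] at h3
    omega
  have hcj' : (R.viewAt (ldr g) (j + 1)).phase m' = Phase.committed := by
    cases hph : (R.viewAt (ldr g) (j + 1)).phase m' with
    | start => exact absurd hph hns
    | proposed =>
      have h1 := huj m' hph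
      rw [hF.globalTS_eq hj hk hcj hck, hF.localTS_eq hj hk hns hnk] at h1
      exact absurd hle (not_le.2 h1)
    | committed => rfl
  have hij' : i' ≤ j := Nat.lt_succ_iff.1 (hF.multicast_lt hj hns hm')
  have hpos : 0 < R.time i' - R.time i := ENNReal.ofReal_pos.1 (hc₀.trans_le hc)
  calc c + d ≤ ENNReal.ofReal (R.time i' - R.time i) + ENNReal.ofReal (R.time j - R.time i') :=
        add_le_add hc (hd.trans (iInf₂_le j ⟨hij', hcj'⟩))
    _ = ENNReal.ofReal (R.time j - R.time i) := by
        rw [← ENNReal.ofReal_add hpos.le (sub_nonneg.2 (R.time_mono hij'))]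
        congr 1
        ring
    _ ≤ ENNReal.ofReal (R.time n - R.time i) :=
        ENNReal.ofReal_le_ofReal (sub_le_sub_right (R.time_mono hjn) _)

end FollowsSkeen
end Run

/-! ### Latencies of a protocol -/

namespace Protocol

theorem HasFailureFreeLatency.hasCollisionFreeLatency {Δ : ℝ≥0∞}
    (h : A.HasFailureFreeLatency Y Δ) : A.HasCollisionFreeLatency Y Δ := by
  intro R
  obtain ⟨t, ht, h⟩ := h R
  exact ⟨t, ht, fun m i hm hi _ ↦ h m i hm hi⟩

namespace Stabilization

variable (σ : Stabilization Y A)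

theorem le_commitLatency {R : Run Y A} {m : M} {i : ℕ} {g : G} (hm : R.MulticastAt m i)
    (hi : σ.t R < R.time i) (hg : g ∈ Y.dest m) :
    R.commitLatency (σ.ldr R g) m i ≤ σ.commitLatency :=
  le_iSup_of_le R <| le_iSup_of_le m <| le_iSup_of_le i <| le_iSup_of_le ⟨hm, hi⟩ <|
    le_iSup_of_le g <| le_iSup_of_le hg le_rfl

theorem le_clockUpdateLatency {R : Run Y A} {m : M} {i : ℕ} {g : G} (hm : R.MulticastAt m i)
    (hi : σ.t R < R.time i) (hg : g ∈ Y.dest m) :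
    R.clockUpdateLatency (σ.ldr R g) m i ≤ σ.clockUpdateLatency :=
  le_iSup_of_le R <| le_iSup_of_le m <| le_iSup_of_le i <| le_iSup_of_le ⟨hm, hi⟩ <|
    le_iSup_of_le g <| le_iSup_of_le hg le_rfl

end Stabilization

namespace SkeenBased

variable [LinearOrder G] (hA : A.SkeenBased Y) (σ : Stabilization Y A)

include hA

theorem clockUpdateLatency_le_commitLatency : σ.clockUpdateLatency ≤ σ.commitLatency :=
  iSup_le fun R ↦ iSup_le fun _ ↦ iSup_le fun _ ↦ iSup_le fun h ↦ iSup_le fun g ↦ iSup_le fun hg ↦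
    ((hA.skeen R _ _ (σ.stable R)).clockUpdateLatency_le_commitLatency g h.2).trans
      (σ.le_commitLatency h.1 h.2 hg)

/-- Every commit latency is replayed by a late collision-free message, which is delivered only after
its commit. -/
theorem commitLatency_le_of_hasCollisionFreeLatency {Δ : ℝ≥0∞}
    (h : A.HasCollisionFreeLatency Y Δ) : σ.commitLatency ≤ Δ := by
  refine iSup_le fun R ↦ iSup_le fun m ↦ iSup_le fun i ↦ iSup_le fun hm ↦ iSup_le fun g ↦
    iSup_le fun hg ↦ ?_
  obtain ⟨R', t', ldr', hs', hreplay⟩ := hA.replay R _ _ (σ.stable R) m i hm.1 hm.2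
  obtain ⟨T, -, hT⟩ := h R'
  obtain ⟨m', i', hm', hi', hcf, hdest, heq⟩ := hreplay (max t' T)
  rw [← heq g hg]
  exact ((hA.skeen R' t' ldr' hs').commitLatency_le_deliveryLatency hA.correct hs' g hm'
    ((le_max_left _ _).trans_lt hi')).trans
    (hT m' i' hm' ((le_max_right _ _).trans_lt hi') hcf g (hdest ▸ hg))

theorem collisionFreeLatency_eq [Finite G] : A.collisionFreeLatency Y = σ.commitLatency := by
  refine le_antisymm (sInf_le fun R ↦ ?_)
    (le_sInf fun Δ hΔ ↦ hA.commitLatency_le_of_hasCollisionFreeLatency σ hΔ)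
  have hs := σ.stable R
  have hF := hA.skeen R _ _ hs
  obtain ⟨T, hT, hlate⟩ := hF.eventually_proposed_late hA.correct hs
  refine ⟨T, hs.1.trans hT, fun m i hm hi hcf g hg ↦ ?_⟩
  exact (hF.deliveryLatency_le_commitLatency hA.correct hs hm (hT.trans_lt hi) hg hcf
    fun k m' ↦ hlate m i g k m' hm hi hg).trans (σ.le_commitLatency hm (hT.trans_lt hi) hg)

/-- A blocking message is multicast at most `C` after the blocked one. -/
theorem time_le_of_localTS_le (hC : σ.clockUpdateLatency ≠ ⊤) {R : Run Y A} {m m' : M}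
    {i i' k : ℕ} {g : G} (hm : R.MulticastAt m i) (hi : σ.t R < R.time i) (hg : g ∈ Y.dest m)
    (hm' : R.MulticastAt m' i') (hik : i ≤ k)
    (hck : (R.viewAt (σ.ldr R g) k).phase m = Phase.committed)
    (hnk : (R.viewAt (σ.ldr R g) k).phase m' ≠ Phase.start)
    (hle : (R.viewAt (σ.ldr R g) k).localTS m' ≤ (R.viewAt (σ.ldr R g) k).globalTS m) :
    R.time i' ≤ R.time i + σ.clockUpdateLatency.toReal := by
  obtain ⟨u, hiu, hu, l, hil, hcl, hclock⟩ :=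
    R.exists_clock_of_clockUpdateLatency_le hC (σ.le_clockUpdateLatency hm hi hg)
  have hti : ∀ {n}, i ≤ n → σ.t R ≤ R.time n := fun h ↦ hi.le.trans (R.time_mono h)
  exact (R.time_mono ((hA.skeen R _ _ (σ.stable R)).multicast_le_of_localTS_le hm' (hti hiu)
    (hti (hil.trans l.le_succ)) hcl hclock (hti hik) hck hnk hle)).trans hu

theorem hasFailureFreeLatency_add [Finite G] :
    A.HasFailureFreeLatency Y (σ.clockUpdateLatency + σ.commitLatency) := by
  intro R
  have hs := σ.stable R
  have hF := hA.skeen R _ _ hs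
  obtain ⟨T, hT, hlate⟩ := hF.eventually_proposed_late hA.correct hs
  refine ⟨T, hs.1.trans hT, fun m i hm hi g hg ↦ ?_⟩
  by_cases htop : σ.clockUpdateLatency + σ.commitLatency = ⊤
  · simp [htop]
  obtain ⟨hC, hD⟩ := ENNReal.add_ne_top.1 htop
  have hti := hT.trans_lt hi
  refine hF.deliveryLatency_le hs htop hti (fun k m' ↦ hlate m i g k m' hm hi hg)
    ((σ.le_commitLatency hm hti hg).trans le_add_self)
    fun m' i' k hm' hi' hg' hik hck hnk hle ↦ ?_
  have h1 := hA.time_le_of_localTS_le σ hC hm hti hg hm' hik hck hnk hle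
  obtain ⟨k', hik', hck', hk'⟩ :=
    R.exists_committed_of_commitLatency_le hD (σ.le_commitLatency hm' hi' hg')
  refine ⟨k', hik', hck', ?_⟩
  rw [ENNReal.toReal_add hC hD]
  linarith

/-- If `c` and `d` witness that worst-case convoys are impossible, then a blocking message is
multicast less than `c` after the blocked one, or committed in less than `d`. -/
theorem exists_hasFailureFreeLatency_lt [Finite G] (hD : σ.commitLatency ≠ ⊤)
    (h : ¬ σ.HasWorstCaseConvoys) :
    ∃ Δ < σ.clockUpdateLatency + σ.commitLatency, A.HasFailureFreeLatency Y Δ := by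
  have hC : σ.clockUpdateLatency ≠ ⊤ :=
    ne_top_of_le_ne_top hD (hA.clockUpdateLatency_le_commitLatency σ)
  unfold Stabilization.HasWorstCaseConvoys at h
  push Not at h
  obtain ⟨c, hc, d, hd, hno⟩ := h
  have hlt : max (c + σ.commitLatency) (σ.clockUpdateLatency + d) <
      σ.clockUpdateLatency + σ.commitLatency :=
    max_lt (ENNReal.add_lt_add_right hD hc) (ENNReal.add_lt_add_left hC hd)
  have htop := hlt.ne_top
  refine ⟨_, hlt, fun R ↦ ?_⟩
  have hs := σ.stable R
  have hF := hA.skeen R _ _ hs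
  obtain ⟨T, hT, hlate⟩ := hF.eventually_proposed_late hA.correct hs
  obtain ⟨T', hno⟩ := hno R
  refine ⟨max T T', hs.1.trans (hT.trans (le_max_left _ _)), fun m i hm hi g hg ↦ ?_⟩
  have hiT := (le_max_left _ _).trans_lt hi
  have hti := hT.trans_lt hiT
  refine hF.deliveryLatency_le hs htop hti (fun k m' ↦ hlate m i g k m' hm hiT hg)
    ((σ.le_commitLatency hm hti hg).trans (le_add_self.trans (le_max_left _ _)))
    fun m' i' k hm' hi' hg' hik hck hnk hle ↦ ?_
  by_cases hcc : c ≤ ENNReal.ofReal (R.time i' - R.time i)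
  · have h1 := hA.time_le_of_localTS_le σ hC hm hti hg hm' hik hck hnk hle
    have h2 := hno m i m' i' hm hm' ((le_max_right _ _).trans_lt hi) hcc g
      (Finset.mem_inter.2 ⟨hg, hg'⟩) ⟨k, hik, hck, hnk, hle⟩
    obtain ⟨k', hik', hck', hk'⟩ := R.exists_committed_of_commitLatency_le hd.ne_top h2.le
    refine ⟨k', hik', hck', ?_⟩
    have h3 := ENNReal.toReal_mono htop (le_max_right (c + σ.commitLatency) _)
    rw [ENNReal.toReal_add hC hd.ne_top] at h3
    linarith
  · have h1 := (ENNReal.ofReal_le_iff_le_toReal hc.ne_top).1 (not_le.1 hcc).le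
    obtain ⟨k', hik', hck', hk'⟩ :=
      R.exists_committed_of_commitLatency_le hD (σ.le_commitLatency hm' hi' hg')
    refine ⟨k', hik', hck', ?_⟩
    have h3 := ENNReal.toReal_mono htop (le_max_left _ (σ.clockUpdateLatency + d))
    rw [ENNReal.toReal_add hc.ne_top hD] at h3
    linarith

/-- Convoys with `c` and `d` close to `C` and `D` exclude failure-free latencies below `C + D`. -/
theorem add_le_of_hasWorstCaseConvoys (hconv : σ.HasWorstCaseConvoys) {Δ : ℝ≥0∞}
    (hΔ : A.HasFailureFreeLatency Y Δ) : σ.clockUpdateLatency + σ.commitLatency ≤ Δ := by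
  have hD := hA.commitLatency_le_of_hasCollisionFreeLatency σ hΔ.hasCollisionFreeLatency
  have key : ∀ c, 0 < c → c < σ.clockUpdateLatency → ∀ d < σ.commitLatency, c + d ≤ Δ := by
    intro c hc₀ hc d hd
    obtain ⟨R, hR⟩ := hconv c hc d hd
    have hs := σ.stable R
    obtain ⟨T, -, hT⟩ := hΔ R
    obtain ⟨m, i, m', i', hm, hm', hi, hci, g, hg, ⟨k, hik, hck, hnk, hle⟩, hdm⟩ :=
      hR (max (σ.t R) T)
    exact ((hA.skeen R _ _ hs).add_le_deliveryLatency_of_convoy hA.correct hs hm hm'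
      ((le_max_left _ _).trans_lt hi) hc₀ hci hik hck hnk hle hdm).trans
      (hT m i hm ((le_max_right _ _).trans_lt hi) g (Finset.mem_inter.1 hg).1)
  -- Convoys with `c = 0` say nothing about the order of the two messages, and there are none with
  -- `d < D` if `D = 0`.
  rcases eq_or_ne σ.clockUpdateLatency 0 with hC₀ | hC₀
  · simpa [hC₀] using hD
  have hD₀ : σ.commitLatency ≠ 0 := fun h ↦
    hC₀ (le_antisymm (h ▸ hA.clockUpdateLatency_le_commitLatency σ) zero_le)
  refine le_of_forall_lt_imp_le_of_dense fun x hx ↦ ?_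
  obtain ⟨c, hc, d, hd, hx⟩ := ENNReal.exists_lt_add_of_lt_add hx hC₀ hD₀
  obtain ⟨e, he₀, he⟩ := exists_between (pos_iff_ne_zero.2 hC₀)
  calc x ≤ c + d := hx.le
    _ ≤ max c e + d := by gcongr; exact le_max_left c e
    _ ≤ Δ := key _ (he₀.trans_le (le_max_right c e)) (max_lt hc he) d hd

end SkeenBased
end Protocol
end Multicast

theorem mainTheorem2 {P : Type*} {G : Type*} {M : Type*} [Fintype P] [Fintype G] [LinearOrder G]
    (Y : Multicast.System P G M) (A : Multicast.Protocol P G M)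
    (hA : A.SkeenBased Y) (σ : Multicast.Protocol.Stabilization Y A) :
    A.HasFailureFreeLatency Y (σ.clockUpdateLatency + A.collisionFreeLatency Y) ∧
    (A.collisionFreeLatency Y ≠ ⊤ →
      (A.failureFreeLatency Y = σ.clockUpdateLatency + A.collisionFreeLatency Y ↔
        σ.HasWorstCaseConvoys)) := by
  rw [hA.collisionFreeLatency_eq σ]
  refine ⟨hA.hasFailureFreeLatency_add σ, fun hD ↦ ⟨fun heq ↦ ?_, fun hconv ↦ ?_⟩⟩
  · by_contra hno
    obtain ⟨Δ, hlt, hΔ⟩ := hA.exists_hasFailureFreeLatency_lt σ hD hno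
    exact absurd heq (lt_of_le_of_lt (sInf_le hΔ) hlt).ne
  · exact le_antisymm (sInf_le (hA.hasFailureFreeLatency_add σ))
      (le_sInf fun Δ hΔ ↦ hA.add_le_of_hasWorstCaseConvoys σ hconv hΔ)
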